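/- For an ordinal $\gamma$ let $\mathcal C(\gamma)$ denote the Banach space of continuous real-valued functions on the compact ordinal interval $[0,\gamma]$ (order topology), with the supremum norm. For compact Hausdorff spaces $K,L$, a positive isomorphism $T:\mathcal C(K)\to\mathcal C(L)$ is a bounded linear bijection with bounded inverse such that $Tf\ge 0$ whenever $f\ge 0$ (nothing is assumed about the positivity of $T^{-1}$), and $$d_{BM}^+(\mathcal C(K),\mathcal C(L))=\inf\{\|T\|\cdot\|T^{-1}\| : T:\mathcal C(K)\to\mathcal C(L)\text{ a positive isomorphism}\}\in[0,\infty],$$ with $\inf\emptyset=\infty$. Let $\alpha,\beta$ be countable nonzero ordinals and let $n\ge 1$ be an integer. Then (with ordinal arithmetic) (i) $d_{BM}^+\big(\mathcal C(\omega^{\alpha}+\beta),\,\mathcal C(\omega^{\alpha n}\cdot\beta)\big)\le n+1+\sqrt{n(n+4)}$; (ii) $d_{BM}^+\big(\mathcal C(\omega^{\alpha}),\,\mathcal C(\omega^{\alpha n})\big)\le n+\sqrt{(n-1)(n+3)}$. Moreover, in each case there is a positive isomorphism $T$ from the first space onto the second for which $\|T\|\cdot\|T^{-1}\|$ is at most the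 stated bound. -/

import Mathlib

open scoped ENNReal Ordinal Cardinal

universe u

noncomputable section

/-- The closed ordinal interval `[0, γ]` with its order topology; `C(γ)` in the usual notation is
`C(OrdInterval γ, ℝ)` with the supremum norm. -/
abbrev OrdInterval (γ : Ordinal.{u}) : Type (u + 1) := Set.Icc (0 : Ordinal.{u}) γ

/-- A surjective linear isomorphism `T : C(K) → C(L)` (bounded, with bounded inverse) is (one-sided)
positive if `T f ≥ 0` whenever `f ≥ 0`. Nothing is required of the inverse. -/
def IsPositiveIso {K L : Type*} [TopologicalSpace K] [CompactSpace K] [TopologicalSpace L]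
    [CompactSpace L] (T : C(K, ℝ) ≃L[ℝ] C(L, ℝ)) : Prop :=
  ∀ f : C(K, ℝ), 0 ≤ f → 0 ≤ T f

/-- The number `‖T‖ * ‖T⁻¹‖`, with operator norms taken with respect to the supremum norms. -/
def distortion {K L : Type*} [TopologicalSpace K] [CompactSpace K] [TopologicalSpace L]
    [CompactSpace L] (T : C(K, ℝ) ≃L[ℝ] C(L, ℝ)) : ℝ :=
  ‖(T : C(K, ℝ) →L[ℝ] C(L, ℝ))‖ * ‖(T.symm : C(L, ℝ) →L[ℝ] C(K, ℝ))‖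

/-- The one-sided positive Banach-Mazur distance from `C(K)` to `C(L)`: the infimum of
`‖T‖ * ‖T⁻¹‖` over all positive isomorphisms `T` of `C(K)` onto `C(L)`; it is `∞` if there are
none. -/
def positiveBanachMazurDist (K L : Type*) [TopologicalSpace K] [CompactSpace K]
    [TopologicalSpace L] [CompactSpace L] : ℝ≥0∞ :=
  ⨅ (T : C(K, ℝ) ≃L[ℝ] C(L, ℝ)) (_ : IsPositiveIso T), ENNReal.ofReal (distortion T)

end

/-!
Write `κ = ω ^ α`, so that `ω ^ (α n) = κ ^ n`, and let `r j` round an ordinal up to a multiple of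
`κ ^ j`. On `Y = [0, κ ^ n * β]` these are continuous retractions onto decreasing closed sets
`L j`, the multiples of `κ ^ j`. A layer `L j \ L (j + 1)` with `j < n` is a disjoint union of
countably many copies of the interval `(0, κ)`. Cutting these copies at the partial sums of a
sequence which is cofinal in `κ`, and stringing the countably many pieces of all layers together,
gives a homeomorphism from the disjoint union of the `n` layers onto `[0, κ)`
(`LayerTiling.nonempty` and the lemmas on `LayerTiling.toLine`). Hence there are continuous maps
`ψ j : Y → [0, κ]`, for `j < n`, that factor through `r j`, send `L (j + 1)` to `κ`, and together
map the layers bijectively onto `[0, κ)`. The last set `L n` is a copy of `[κ, κ + β]` through a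
map `p`.

Put `T f = a • f ∘ p + b • ∑ j < n, f ∘ ψ j` with `a, b > 0` and `a + n b = 1`. This is a positive
operator of norm at most `1`. Composing `F = T f` with `r j` freezes the terms with index below `j`,
so the sum telescopes, and `F` determines `f` by
* `f κ = F 0`,
* `b * (f (ψ j y) - f κ) = F (r j y) - F (r (j + 1) y)`,
* `a * f (p y) = F (r n y) - n b * F 0`.

Conversely these formulas define a continuous function `f` for every continuous `F`, because
`[0, κ + β]` is a quotient of a disjoint union of copies of `Y`. So `T` is an isomorphism whose
inverse has norm at most `max (1 + 2 / b) ((1 + n b) / a)`. The two terms agree when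
`n b (b + 1) = 1`, and their common value is then `n + 1 + √(n (n + 4))`. This argument is
`LayeredMaps.exists_isPositiveIso`, and the maps are those of `layeredMapsAdd`.

For `C(ω ^ α)` and `C(ω ^ (α n))` the same operator is used with `n - 1` in place of `n`: after
removing `0` from `Y = [0, κ ^ n]` (which does not change its homeomorphism type), the set `L n` is
the single point `κ ^ n`. It takes over the role of the base point `0`, and the map `ψ (n - 1)` that
of `p` (`layeredMapsPow`).
-/

/-! ### Layered maps and the isomorphism they define -/

/-- A system of continuous maps between compact spaces `Y` and `X` with base points `y₀`, `x₀`.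
The maps `r 0 = id, r 1, …, r m` are to be thought of as retractions of `Y` onto decreasing closed
subsets `Y = L 0 ⊇ L 1 ⊇ … ⊇ L m`. The map `ψ j` factors through `r j`, is injective on the layer
`L j \ L (j + 1)` and sends `L (j + 1)` to `x₀`, and `p` factors through `r m` and is injective on
`L m`. The images of the `ψ j` and of `p` cover `X`, and they meet only in `x₀`. -/
structure LayeredMaps (X Y : Type*) [TopologicalSpace X] [TopologicalSpace Y] (m : ℕ) where
  /-- The retraction onto the `j`-th closed subset. -/
  r : ℕ → Y → Y
  /-- The map that carries the `j`-th layer into `X`. -/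
  ψ : ℕ → Y → X
  /-- The map that carries the last closed subset into `X`. -/
  p : Y → X
  /-- The base point of `X`, at which the images of the layers meet. -/
  x₀ : X
  /-- A point of `Y` that all the maps to `X` send to the base point. -/
  y₀ : Y
  continuous_r : ∀ j, Continuous (r j)
  continuous_ψ : ∀ j, Continuous (ψ j)
  continuous_p : Continuous p
  r_zero : ∀ y, r 0 y = y
  p_r : ∀ k ≤ m, ∀ y, p (r k y) = p y
  ψ_r_of_le : ∀ j < m, ∀ k ≤ j, ∀ y, ψ j (r k y) = ψ j y
  ψ_r_of_lt : ∀ k ≤ m, ∀ j < k, ∀ y, ψ j (r k y) = x₀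
  p_y₀ : p y₀ = x₀
  ψ_y₀ : ∀ j < m, ψ j y₀ = x₀
  cover : ∀ x, (∃ y, p y = x) ∨ ∃ j < m, ∃ y, ψ j y = x
  p_eq_p : ∀ y z, p y = p z → r m y = r m z
  ψ_eq_ψ : ∀ j < m, ∀ k < m, ∀ y z, ψ j y = ψ k z →
    (j = k ∧ r j y = r j z ∧ r (j + 1) y = r (j + 1) z) ∨
      (r j y = r (j + 1) y ∧ r k z = r (k + 1) z)
  p_eq_ψ : ∀ j < m, ∀ y z, p y = ψ j z → r m y = y₀ ∧ r j z = r (j + 1) z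

namespace LayeredMaps

variable {X Y : Type*} [TopologicalSpace X] [TopologicalSpace Y] {m : ℕ} (D : LayeredMaps X Y m)

/-- The operator `f ↦ a • f ∘ p + b • ∑ j < m, f ∘ ψ j`. -/
noncomputable def op (a b : ℝ) : C(X, ℝ) →ₗ[ℝ] C(Y, ℝ) where
  toFun f := a • f.comp ⟨D.p, D.continuous_p⟩ +
    b • ∑ j ∈ Finset.range m, f.comp ⟨D.ψ j, D.continuous_ψ j⟩
  map_add' f g := by
    ext y
    simp [Finset.sum_add_distrib]
    ring
  map_smul' c f := by
    ext y
    simp [← Finset.mul_sum]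
    ring

lemma op_apply (a b : ℝ) (f : C(X, ℝ)) (y : Y) :
    D.op a b f y = a * f (D.p y) + b * ∑ j ∈ Finset.range m, f (D.ψ j y) := by
  simp [op]

lemma op_nonneg {a b : ℝ} (ha : 0 ≤ a) (hb : 0 ≤ b) (f : C(X, ℝ)) (hf : 0 ≤ f) :
    0 ≤ D.op a b f := by
  intro y
  change 0 ≤ D.op a b f y
  rw [op_apply]
  have h : ∀ x, 0 ≤ f x := fun x => hf x
  have := Finset.sum_nonneg (fun j (_ : j ∈ Finset.range m) => h (D.ψ j y))
  have := h (D.p y)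
  positivity

lemma norm_op_le [CompactSpace X] [CompactSpace Y] {a b : ℝ}
    (ha : 0 ≤ a) (hb : 0 ≤ b) (hab : a + m * b = 1) (f : C(X, ℝ)) :
    ‖D.op a b f‖ ≤ ‖f‖ := by
  rw [ContinuousMap.norm_le _ (norm_nonneg f)]
  intro y
  rw [op_apply]
  have h1 : ‖∑ j ∈ Finset.range m, f (D.ψ j y)‖ ≤ m * ‖f‖ := by
    refine (norm_sum_le _ _).trans ((Finset.sum_le_sum fun j _ => f.norm_coe_le_norm _).trans ?_)
    simp
  calc ‖a * f (D.p y) + b * ∑ j ∈ Finset.range m, f (D.ψ j y)‖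
      ≤ ‖a * f (D.p y)‖ + ‖b * ∑ j ∈ Finset.range m, f (D.ψ j y)‖ := norm_add_le _ _
    _ ≤ a * ‖f‖ + b * (m * ‖f‖) := by
        rw [norm_mul, norm_mul, Real.norm_of_nonneg ha, Real.norm_of_nonneg hb]
        gcongr
        exact f.norm_coe_le_norm _
    _ = ‖f‖ := by linear_combination ‖f‖ * hab

lemma op_y₀ {a b : ℝ} (hab : a + m * b = 1) (f : C(X, ℝ)) : D.op a b f D.y₀ = f D.x₀ := by
  rw [op_apply, D.p_y₀, Finset.sum_congr rfl fun j hj => by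
    rw [D.ψ_y₀ j (Finset.mem_range.1 hj)]]
  simp
  linear_combination f D.x₀ * hab

/-- Composing with `r k` freezes the terms with index below `k` at the base point. -/
lemma op_r (a b : ℝ) (f : C(X, ℝ)) {k : ℕ} (hk : k ≤ m) (y : Y) :
    D.op a b f (D.r k y) =
      a * f (D.p y) + b * (k * f D.x₀ + ∑ j ∈ Finset.Ico k m, f (D.ψ j y)) := by
  rw [op_apply, D.p_r k hk, Finset.range_eq_Ico,
    ← Finset.sum_Ico_consecutive _ (Nat.zero_le k) hk,
    Finset.sum_congr rfl fun j hj => by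
      rw [D.ψ_r_of_lt k hk j (Finset.mem_Ico.1 hj).2 y],
    Finset.sum_congr (s₁ := Finset.Ico k m) rfl fun j hj => by
      rw [D.ψ_r_of_le j (Finset.mem_Ico.1 hj).2 k (Finset.mem_Ico.1 hj).1 y]]
  simp

lemma op_r_sub_op_r_succ (a b : ℝ) (f : C(X, ℝ)) {k : ℕ} (hk : k < m) (y : Y) :
    D.op a b f (D.r k y) - D.op a b f (D.r (k + 1) y) = b * (f (D.ψ k y) - f D.x₀) := by
  rw [D.op_r a b f hk.le, D.op_r a b f hk, Finset.sum_eq_sum_Ico_succ_bot hk]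
  push_cast
  ring

lemma op_r_last (a b : ℝ) (f : C(X, ℝ)) (y : Y) :
    D.op a b f (D.r m y) = a * f (D.p y) + m * b * f D.x₀ := by
  rw [D.op_r a b f le_rfl]
  simp
  ring

lemma norm_le_mul_norm_op [CompactSpace X] [CompactSpace Y] {a b c : ℝ}
    (ha : 0 < a) (hb : 0 < b) (hab : a + m * b = 1)
    (hac : 1 + m * b ≤ c * a) (hbc : b + 2 ≤ c * b) (f : C(X, ℝ)) :
    ‖f‖ ≤ c * ‖D.op a b f‖ := by
  have hc : 0 ≤ c := by
    by_contra! hc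
    nlinarith
  rw [ContinuousMap.norm_le _ (by positivity)]
  set F := D.op a b f with hF
  have hn : ∀ y, |F y| ≤ ‖F‖ := fun y => F.norm_coe_le_norm y
  have h0 : f D.x₀ = F D.y₀ := (D.op_y₀ hab f).symm
  intro x
  rw [Real.norm_eq_abs]
  rcases D.cover x with ⟨y, rfl⟩ | ⟨j, hj, y, rfl⟩
  · have h1 : a * f (D.p y) = F (D.r m y) - m * b * F D.y₀ := by
      rw [hF, D.op_r_last, ← hF, ← h0]; ring
    have h2 : a * |f (D.p y)| ≤ (1 + m * b) * ‖F‖ := by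
      rw [← abs_of_pos ha, ← abs_mul, h1]
      calc |F (D.r m y) - m * b * F D.y₀| ≤ |F (D.r m y)| + |m * b * F D.y₀| := abs_sub _ _
        _ ≤ ‖F‖ + m * b * ‖F‖ := by
          rw [abs_mul, abs_of_nonneg (by positivity : 0 ≤ m * b)]
          gcongr
          exacts [hn _, hn _]
        _ = (1 + m * b) * ‖F‖ := by ring
    refine le_of_mul_le_mul_left (h2.trans ?_) ha
    calc (1 + m * b) * ‖F‖ ≤ c * a * ‖F‖ := by gcongr
      _ = a * (c * ‖F‖) := by ring
  · have h1 : b * f (D.ψ j y) = b * F D.y₀ + (F (D.r j y) - F (D.r (j + 1) y)) := by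
      rw [hF, D.op_r_sub_op_r_succ a b f hj, ← hF, ← h0]; ring
    have h2 : b * |f (D.ψ j y)| ≤ (b + 2) * ‖F‖ := by
      rw [← abs_of_pos hb, ← abs_mul, h1, abs_of_pos hb]
      calc |b * F D.y₀ + (F (D.r j y) - F (D.r (j + 1) y))|
          ≤ |b * F D.y₀| + (|F (D.r j y)| + |F (D.r (j + 1) y)|) :=
            (abs_add_le _ _).trans (by gcongr; exact abs_sub _ _)
        _ ≤ b * ‖F‖ + (‖F‖ + ‖F‖) := by
          rw [abs_mul, abs_of_pos hb]
          gcongr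
          exacts [hn _, hn _, hn _]
        _ = (b + 2) * ‖F‖ := by ring
    refine le_of_mul_le_mul_left (h2.trans ?_) hb
    calc (b + 2) * ‖F‖ ≤ c * b * ‖F‖ := by gcongr
      _ = b * (c * ‖F‖) := by ring

open Classical in
/-- The function on `X` that `op a b` sends to `F`, given by the inversion formulas on the images
of `p` and of the maps `ψ j`. These cover `X`, so the value `0` in the last case never occurs. -/
noncomputable def invFun (a b : ℝ) (F : Y → ℝ) (x : X) : ℝ :=
  if h : ∃ y, D.p y = x then (F (D.r m h.choose) - m * b * F D.y₀) / a
  else if h : ∃ j < m, ∃ y, D.ψ j y = x then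
    F D.y₀ + (F (D.r h.choose h.choose_spec.2.choose) -
      F (D.r (h.choose + 1) h.choose_spec.2.choose)) / b
  else 0

lemma invFun_p (a b : ℝ) (F : Y → ℝ) (y : Y) :
    D.invFun a b F (D.p y) = (F (D.r m y) - m * b * F D.y₀) / a := by
  have h : ∃ z, D.p z = D.p y := ⟨y, rfl⟩
  rw [invFun, dif_pos h, D.p_eq_p _ _ h.choose_spec]

lemma invFun_ψ {a b : ℝ} (ha : 0 < a) (hab : a + m * b = 1) (F : Y → ℝ) {j : ℕ} (hj : j < m)
    (y : Y) : D.invFun a b F (D.ψ j y) = F D.y₀ + (F (D.r j y) - F (D.r (j + 1) y)) / b := by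
  by_cases h : ∃ z, D.p z = D.ψ j y
  · obtain ⟨h1, h2⟩ := D.p_eq_ψ j hj _ _ h.choose_spec
    rw [invFun, dif_pos h, h1, h2, sub_self, zero_div, add_zero, div_eq_iff ha.ne']
    linear_combination - F D.y₀ * hab
  · have h' : ∃ k < m, ∃ z, D.ψ k z = D.ψ j y := ⟨j, hj, y, rfl⟩
    rw [invFun, dif_neg h, dif_pos h']
    rcases D.ψ_eq_ψ _ h'.choose_spec.1 j hj _ _ h'.choose_spec.2.choose_spec with
      ⟨h1, h2, h3⟩ | ⟨h1, h2⟩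
    · rw [h2, h3, h1]
    · rw [h1, h2, sub_self, sub_self]

/-- The inversion formulas define a continuous function because `X` is a quotient of the disjoint
union of `Y` and the `m` copies of `Y` on which the maps `p` and `ψ j` are defined. -/
lemma continuous_invFun [CompactSpace Y] [T2Space X] {a b : ℝ}
    (ha : 0 < a) (hab : a + m * b = 1) (F : C(Y, ℝ)) :
    Continuous (D.invFun a b F) := by
  let q : Y ⊕ (Σ _ : Fin m, Y) → X := Sum.elim D.p fun z => D.ψ z.1 z.2
  have hq : Continuous q :=
    continuous_sumElim.2 ⟨D.continuous_p, continuous_sigma fun j => D.continuous_ψ j⟩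
  have hs : Function.Surjective q := by
    intro x
    rcases D.cover x with ⟨y, rfl⟩ | ⟨j, hj, y, rfl⟩
    · exact ⟨Sum.inl y, rfl⟩
    · exact ⟨Sum.inr ⟨⟨j, hj⟩, y⟩, rfl⟩
  rw [(Topology.IsQuotientMap.of_surjective_continuous hs hq).continuous_iff]
  refine continuous_sum_dom.2 ⟨?_, continuous_sigma fun j => ?_⟩
  · have : (D.invFun a b F ∘ q) ∘ Sum.inl = fun y => (F (D.r m y) - m * b * F D.y₀) / a :=
      funext fun y => D.invFun_p a b F y
    rw [this]
    have := D.continuous_r m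
    fun_prop
  · have : (fun y => ((D.invFun a b F ∘ q) ∘ Sum.inr) ⟨j, y⟩) =
        fun y => F D.y₀ + (F (D.r j y) - F (D.r (j + 1) y)) / b :=
      funext fun y => D.invFun_ψ ha hab F j.2 y
    rw [this]
    have := D.continuous_r j
    have := D.continuous_r (j + 1)
    fun_prop

lemma op_surjective [CompactSpace Y] [T2Space X] {a b : ℝ}
    (ha : 0 < a) (hb : 0 < b) (hab : a + m * b = 1) :
    Function.Surjective (D.op a b) := by
  intro F
  refine ⟨⟨_, D.continuous_invFun ha hab F⟩, ?_⟩
  ext y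
  rw [op_apply]
  simp only [ContinuousMap.coe_mk]
  rw [D.invFun_p, Finset.sum_congr rfl fun j hj => D.invFun_ψ ha hab F (Finset.mem_range.1 hj) y,
    Finset.sum_add_distrib, ← Finset.sum_div, Finset.sum_range_sub' fun j => F (D.r j y), D.r_zero]
  simp
  field_simp
  ring

/-- With the weights `b = 2 / (m + √(m (m + 4)))` and `a = 1 - m b`, so that `m b (b + 1) = 1`, the
two bounds `(1 + m b) / a` and `1 + 2 / b` for the norm of the inverse coincide. -/
theorem exists_isPositiveIso [CompactSpace X] [CompactSpace Y] [T2Space X]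
    (D : LayeredMaps X Y m) (hm : 1 ≤ m) :
    ∃ T : C(X, ℝ) ≃L[ℝ] C(Y, ℝ), IsPositiveIso T ∧
      distortion T ≤ (m : ℝ) + 1 + √((m : ℝ) * ((m : ℝ) + 4)) := by
  have hm' : (1 : ℝ) ≤ m := by exact_mod_cast hm
  set s := √((m : ℝ) * ((m : ℝ) + 4)) with hs
  have hs2 : s ^ 2 = (m : ℝ) * ((m : ℝ) + 4) := Real.sq_sqrt (by positivity)
  have hs0 : 0 ≤ s := Real.sqrt_nonneg _
  have hms : 0 < (m : ℝ) + s := by positivity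
  obtain ⟨b, hb⟩ : ∃ b, b = 2 / ((m : ℝ) + s) := ⟨_, rfl⟩
  have hb0 : 0 < b := by rw [hb]; positivity
  have hbs : b * (m + s) = 2 := by rw [hb]; field_simp
  have hquad : m * b * (b + 1) = 1 := by
    have h : (m * b * (b + 1) - 1) * (m + s) ^ 2 = 0 := by
      linear_combination (m * b * (m + s) + 2 * m + m * (m + s)) * hbs - hs2
    have := (mul_eq_zero.1 h).resolve_right (by positivity)
    linarith
  obtain ⟨a, ha⟩ : ∃ a, a = 1 - m * b := ⟨_, rfl⟩
  have hab : a + m * b = 1 := by rw [ha]; ring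
  have ha' : a * (b + 1) = b := by rw [ha]; linear_combination -hquad
  have ha0 : 0 < a := by
    by_contra! h
    nlinarith
  have hbc : b + 2 = ((m : ℝ) + 1 + s) * b := by linear_combination -hbs
  have hac : 1 + m * b = ((m : ℝ) + 1 + s) * a := by
    have h : (1 + m * b - ((m : ℝ) + 1 + s) * a) * (b + 1) = 0 := by
      linear_combination hquad - ((m : ℝ) + 1 + s) * ha' + hbc
    have := (mul_eq_zero.1 h).resolve_right (by positivity)
    linarith
  have hle := D.norm_le_mul_norm_op ha0 hb0 hab hac.le hbc.le
  have hinj : Function.Injective (D.op a b) := by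
    refine (injective_iff_map_eq_zero _).2 fun f hf => ?_
    have := hle f
    rw [hf, norm_zero, mul_zero] at this
    exact norm_le_zero_iff.1 this
  let E : C(X, ℝ) ≃ₗ[ℝ] C(Y, ℝ) :=
    LinearEquiv.ofBijective (D.op a b) ⟨hinj, D.op_surjective ha0 hb0 hab⟩
  have h1 : ∀ f, ‖E f‖ ≤ 1 * ‖f‖ := fun f => by
    rw [one_mul]; exact D.norm_op_le ha0.le hb0.le hab f
  have h2 : ∀ F, ‖E.symm F‖ ≤ ((m : ℝ) + 1 + s) * ‖F‖ := fun F => by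
    have := hle (E.symm F)
    rwa [show D.op a b (E.symm F) = F from E.apply_symm_apply F] at this
  refine ⟨E.toContinuousLinearEquivOfBounds _ _ h1 h2, D.op_nonneg ha0.le hb0.le, ?_⟩
  calc _ ≤ 1 * ((m : ℝ) + 1 + s) :=
        mul_le_mul (ContinuousLinearMap.opNorm_le_bound _ zero_le_one h1)
          (ContinuousLinearMap.opNorm_le_bound _ (by positivity) h2) (norm_nonneg _) zero_le_one
    _ = _ := one_mul _

end LayeredMaps

/-! ### Continuity of ordinal-valued functions -/

lemma Ordinal.isClopen_Iic (b : Ordinal.{u}) : IsClopen (Set.Iic b) :=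
  ⟨_root_.isClosed_Iic, by rw [← Order.Iio_succ]; exact isOpen_Iio⟩

lemma Ordinal.isClopen_Ioi (b : Ordinal.{u}) : IsClopen (Set.Ioi b) := by
  simpa using (Ordinal.isClopen_Iic b).compl

/-- Closed initial segments of the ordinals are clopen, and the preimage of `Iio b` is the union of
the preimages of the `Iic c` with `c < b`. -/
lemma Ordinal.continuous_of_isClopen_le {Y : Type*} [TopologicalSpace Y] {f : Y → Ordinal.{u}}
    (h : ∀ b, IsClopen {y | f y ≤ b}) : Continuous f := by
  refine OrderTopology.continuous_iff.2 fun b => ⟨?_, ?_⟩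
  · have : f ⁻¹' Set.Ioi b = {y | f y ≤ b}ᶜ := by ext; simp
    rw [this]
    exact (h b).compl.isOpen
  · have : f ⁻¹' Set.Iio b = ⋃ c ∈ Set.Iio b, {y | f y ≤ c} := by
      ext y
      simp only [Set.mem_preimage, Set.mem_Iio, Set.mem_iUnion, Set.mem_ofPred_eq, exists_prop]
      exact ⟨fun hy => ⟨_, hy, le_rfl⟩, fun ⟨c, hc, hy⟩ => hy.trans_lt hc⟩
    rw [this]
    exact isOpen_biUnion fun c _ => (h c).isOpen

lemma Ordinal.continuous_sub_const (c : Ordinal.{u}) : Continuous fun x : Ordinal.{u} => x - c := by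
  refine continuous_of_isClopen_le fun b => ?_
  simp only [Ordinal.sub_le]
  exact isClopen_Iic _

lemma Ordinal.continuous_const_mul {δ : Ordinal.{u}} (hδ : δ ≠ 0) :
    Continuous fun x : Ordinal.{u} => δ * x := by
  refine continuous_of_isClopen_le fun b => ?_
  simp only [Ordinal.mul_le_iff_le_div hδ]
  exact isClopen_Iic _

lemma Ordinal.continuous_const_add (c : Ordinal.{u}) : Continuous fun x : Ordinal.{u} => c + x := by
  refine continuous_of_isClopen_le fun b => ?_
  by_cases h : c ≤ b
  · simp only [← Ordinal.le_sub_of_le h]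
    exact isClopen_Iic _
  · convert isClopen_empty
    ext x
    simpa using (not_le.1 h).trans_le (le_add_right le_rfl)

/-! ### Rounding ordinals up to multiples of a given ordinal -/

/-- The least `q` with `x ≤ δ * q`, for `δ ≠ 0`. -/
noncomputable def Ordinal.ceilQuot (x δ : Ordinal.{u}) : Ordinal.{u} := sInf {q | x ≤ δ * q}

namespace Ordinal

variable {δ κ x b : Ordinal.{u}}

lemma ceilQuot_le_iff (hδ : δ ≠ 0) : ceilQuot x δ ≤ b ↔ x ≤ δ * b := by
  refine ⟨fun h => ?_, fun h => csInf_le' h⟩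
  have h1 : x ≤ δ * ceilQuot x δ :=
    csInf_mem (s := {q | x ≤ δ * q}) ⟨x, Ordinal.le_mul_right x (_root_.pos_iff_ne_zero.2 hδ)⟩
  exact h1.trans (mul_le_mul_right h δ)

lemma le_mul_ceilQuot (hδ : δ ≠ 0) : x ≤ δ * ceilQuot x δ := (ceilQuot_le_iff hδ).1 le_rfl

lemma continuous_ceilQuot (hδ : δ ≠ 0) : Continuous fun x : Ordinal.{u} => ceilQuot x δ := by
  refine continuous_of_isClopen_le fun b => ?_
  simp only [ceilQuot_le_iff hδ]
  exact isClopen_Iic _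

lemma ceilQuot_mul_cancel (hδ : δ ≠ 0) (q : Ordinal.{u}) : ceilQuot (δ * q) δ = q :=
  eq_of_forall_ge_iff fun b => by
    rw [ceilQuot_le_iff hδ, mul_le_mul_iff_right₀ (_root_.pos_iff_ne_zero.2 hδ)]

@[simp]
lemma ceilQuot_zero (δ : Ordinal.{u}) : ceilQuot 0 δ = 0 :=
  le_antisymm (csInf_le' (by simp)) (zero_le)

lemma ceilQuot_one_right (x : Ordinal.{u}) : ceilQuot x 1 = x := by
  simpa using ceilQuot_mul_cancel (one_ne_zero) x

lemma ceilQuot_pos (hδ : δ ≠ 0) (hx : 0 < x) : 0 < ceilQuot x δ := by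
  by_contra! h
  rw [ceilQuot_le_iff hδ, mul_zero] at h
  exact hx.not_ge h

lemma ceilQuot_pow_round_of_le (hκ : κ ≠ 0) {j k : ℕ} (h : k ≤ j) (x : Ordinal.{u}) :
    ceilQuot (κ ^ k * ceilQuot x (κ ^ k)) (κ ^ j) = ceilQuot x (κ ^ j) :=
  eq_of_forall_ge_iff fun b => by
    rw [ceilQuot_le_iff (pow_ne_zero _ hκ), ceilQuot_le_iff (pow_ne_zero _ hκ),
      ← Nat.add_sub_cancel' h, pow_add, mul_assoc,
      mul_le_mul_iff_right₀ (_root_.pos_iff_ne_zero.2 (pow_ne_zero _ hκ)),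
      ceilQuot_le_iff (pow_ne_zero _ hκ)]

lemma dvd_ceilQuot_pow_mul (hκ : κ ≠ 0) {j k : ℕ} (h : j < k) (c : Ordinal.{u}) :
    κ ∣ ceilQuot (κ ^ k * c) (κ ^ j) := by
  obtain ⟨i, rfl⟩ := Nat.exists_eq_add_of_lt h
  rw [add_assoc, pow_add, mul_assoc, ceilQuot_mul_cancel (pow_ne_zero _ hκ), pow_succ', mul_assoc]
  exact dvd_mul_right _ _

lemma round_eq_round_succ (hκ : κ ≠ 0) {j : ℕ} (h : κ ∣ ceilQuot x (κ ^ j)) :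
    κ ^ j * ceilQuot x (κ ^ j) = κ ^ (j + 1) * ceilQuot x (κ ^ (j + 1)) := by
  obtain ⟨c, hc⟩ := h
  rw [← ceilQuot_pow_round_of_le hκ (Nat.le_succ j), hc, ← mul_assoc, ← pow_succ,
    ceilQuot_mul_cancel (pow_ne_zero _ hκ)]

lemma round_succ_congr (hκ : κ ≠ 0) {j : ℕ} {y : Ordinal.{u}}
    (h : ceilQuot x (κ ^ j) = ceilQuot y (κ ^ j)) :
    ceilQuot x (κ ^ (j + 1)) = ceilQuot y (κ ^ (j + 1)) := by
  rw [← ceilQuot_pow_round_of_le hκ (Nat.le_succ j), h, ceilQuot_pow_round_of_le hκ (Nat.le_succ j)]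

/-! ### Partial sums of sequences of ordinals -/

/-- The sum `η 0 + η 1 + ⋯ + η (k - 1)`, in this order. -/
noncomputable def partialSum (η : ℕ → Ordinal.{u}) : ℕ → Ordinal.{u}
  | 0 => 0
  | k + 1 => partialSum η k + η k

lemma partialSum_mono (η : ℕ → Ordinal.{u}) : Monotone (partialSum η) :=
  monotone_nat_of_le_succ fun _ => le_add_right le_rfl

lemma le_partialSum_succ (η : ℕ → Ordinal.{u}) (k : ℕ) : η k ≤ partialSum η (k + 1) :=
  le_add_left le_rfl

lemma partialSum_lt {η : ℕ → Ordinal.{u}} (hκ : IsPrincipal (· + ·) κ) (h0 : 0 < κ)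
    (hη : ∀ i, η i < κ) : ∀ k, partialSum η k < κ
  | 0 => h0
  | k + 1 => hκ (partialSum_lt hκ h0 hη k) (hη k)

lemma exists_partialSum_lt_le {η : ℕ → Ordinal.{u}} (hx : 0 < x) (h : ∃ i, x ≤ η i) :
    ∃ k, partialSum η k < x ∧ x ≤ partialSum η (k + 1) := by
  classical
  have h' : ∃ i, x ≤ partialSum η (i + 1) := h.imp fun i hi => hi.trans (le_partialSum_succ η i)
  refine ⟨Nat.find h', ?_, Nat.find_spec h'⟩
  rcases hk : Nat.find h' with _ | k
  · exact hx
  · exact not_le.1 (Nat.find_min h' (hk ▸ Nat.lt_succ_self k))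

lemma partialSum_index_unique {η : ℕ → Ordinal.{u}} {k l : ℕ}
    (h1 : partialSum η k < x) (h2 : x ≤ partialSum η (k + 1))
    (h3 : partialSum η l < x) (h4 : x ≤ partialSum η (l + 1)) : k = l := by
  refine le_antisymm ?_ ?_ <;> by_contra! h
  · exact (h4.trans (partialSum_mono η (Nat.succ_le_of_lt h))).not_gt h1
  · exact (h2.trans (partialSum_mono η (Nat.succ_le_of_lt h))).not_gt h3

end Ordinal

/-! ### Cutting the layers into intervals and stringing the intervals together -/

open Ordinal

/-- A sequence of half-open ordinal intervals `(left i, left i + len i]`, the `i`-th of which belongs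
to the layer `layer i < n`. For each `j < n`, the intervals of layer `j` partition the set of those
ordinals in `(0, κ * M j]` that are not multiples of `κ`. The lengths are below `κ` and cofinal
in `κ`; intervals of length `0` are allowed. -/
structure LayerTiling (κ : Ordinal.{u}) (n : ℕ) (M : ℕ → Ordinal.{u}) where
  /-- The layer to which the `i`-th interval belongs. -/
  layer : ℕ → ℕ
  /-- The excluded left end point of the `i`-th interval. -/
  left : ℕ → Ordinal.{u}
  /-- The length of the `i`-th interval. -/
  len : ℕ → Ordinal.{u}
  layer_lt : ∀ i, layer i < n
  len_lt : ∀ i, len i < κ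
  cofinal : ∀ b < κ, ∃ i, b ≤ len i
  right_le : ∀ i, left i + len i ≤ κ * M (layer i)
  not_dvd : ∀ i q, left i < q → q ≤ left i + len i → ¬ κ ∣ q
  eq_of_mem : ∀ i i' q, layer i = layer i' → left i < q → q ≤ left i + len i →
    left i' < q → q ≤ left i' + len i' → i = i'
  exists_mem : ∀ j < n, ∀ q ≤ κ * M j, ¬ κ ∣ q →
    ∃ i, layer i = j ∧ left i < q ∧ q ≤ left i + len i

/-- Each interval `(κ s, κ (s + 1))` is cut at the points `κ s + h 0 + ⋯ + h (k - 1)`, where `h`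
enumerates the ordinals below `κ`; there are countably many pieces in all. -/
lemma LayerTiling.nonempty {κ : Ordinal.{u}} (hκ : IsPrincipal (· + ·) κ) (h0 : 0 < κ)
    (hκc : (Set.Iio κ).Countable) {n : ℕ} (hn : 1 ≤ n) {M : ℕ → Ordinal.{u}}
    (hM : ∀ j < n, M j ≠ 0) (hMc : ∀ j < n, (Set.Iio (M j)).Countable) :
    Nonempty (LayerTiling κ n M) := by
  have : ∀ j : Fin n, Countable (Set.Iio (M j)) := fun j => (hMc j j.2).to_subtype
  have : Nonempty (Σ j : Fin n, Set.Iio (M j)) :=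
    ⟨⟨⟨0, hn⟩, ⟨0, pos_iff_ne_zero.2 (hM 0 hn)⟩⟩⟩
  obtain ⟨⟨e⟩⟩ : Nonempty (Nonempty (((Σ j : Fin n, Set.Iio (M j)) × ℕ) ≃ ℕ)) := by
    obtain ⟨d⟩ := nonempty_denumerable ((Σ j : Fin n, Set.Iio (M j)) × ℕ)
    exact ⟨⟨Denumerable.eqv _⟩⟩
  have := hκc.to_subtype
  have : Nonempty (Set.Iio κ) := ⟨⟨0, h0⟩⟩
  obtain ⟨h, hh⟩ := exists_surjective_nat (Set.Iio κ)
  let g : ℕ → Ordinal.{u} := fun k => h k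
  have hg : ∀ k, g k < κ := fun k => (h k).2
  have hgs : ∀ b < κ, ∃ k, b ≤ g k := fun b hb => by
    obtain ⟨k, hk⟩ := hh ⟨b, hb⟩
    exact ⟨k, by simp [g, hk]⟩
  have hlt := partialSum_lt hκ h0 hg
  -- A point of the `k`-th piece of `(κ s, κ (s + 1))` determines `s` and `k` by division by `κ`.
  have key : ∀ s k q, κ * s + partialSum g k < q → q ≤ κ * s + (partialSum g k + g k) →
      ∃ ρ, q = κ * s + ρ ∧ 0 < ρ ∧ ρ < κ ∧ partialSum g k < ρ ∧ ρ ≤ partialSum g (k + 1) := by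
    intro s k q h1 h2
    have hs : κ * s ≤ q := (le_add_right le_rfl).trans h1.le
    obtain ⟨ρ, rfl⟩ : ∃ ρ, q = κ * s + ρ := ⟨q - κ * s, (Ordinal.add_sub_cancel_of_le hs).symm⟩
    have h3 := lt_of_add_lt_add_left h1
    have h4 : ρ ≤ partialSum g (k + 1) := le_of_add_le_add_left h2
    exact ⟨ρ, rfl, (zero_le).trans_lt h3, h4.trans_lt (hlt _), h3, h4⟩
  refine ⟨{
    layer := fun i => (e.symm i).1.1
    left := fun i => κ * (e.symm i).1.2 + partialSum g (e.symm i).2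
    len := fun i => g (e.symm i).2
    layer_lt := fun i => (e.symm i).1.1.2
    len_lt := fun i => hg _
    cofinal := fun b hb => ?_
    right_le := fun i => ?_
    not_dvd := fun i q h1 h2 => ?_
    eq_of_mem := fun i i' q hj h1 h2 h3 h4 => ?_
    exists_mem := fun j hj q hq hd => ?_ }⟩
  · obtain ⟨k, hk⟩ := hgs b hb
    exact ⟨e (Classical.arbitrary _, k), by simpa using hk⟩
  · rw [add_assoc]
    have hs : Order.succ ((e.symm i).1.2 : Ordinal.{u}) ≤ M (e.symm i).1.1 :=
      Order.succ_le_of_lt (e.symm i).1.2.2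
    calc _ ≤ κ * (e.symm i).1.2 + κ := by gcongr; exact (hlt ((e.symm i).2 + 1)).le
      _ = κ * Order.succ ((e.symm i).1.2 : Ordinal.{u}) := (mul_succ _ _).symm
      _ ≤ _ := mul_le_mul_right hs κ
  · rw [add_assoc] at h2
    obtain ⟨ρ, rfl, hρ0, hρ, -⟩ := key _ _ _ h1 h2
    rw [dvd_iff_mod_eq_zero, mul_add_mod_self, mod_eq_of_lt hρ]
    exact hρ0.ne'
  · rw [add_assoc] at h2 h4
    obtain ⟨ρ, h5, -, hρ, h6, h7⟩ := key _ _ _ h1 h2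
    obtain ⟨ρ', h5', -, hρ', h6', h7'⟩ := key _ _ _ h3 h4
    rw [h5] at h5'
    have hdiv := congrArg (· / κ) h5'
    have hmod := congrArg (· % κ) h5'
    simp only [mul_add_div _ h0.ne', div_eq_zero_of_lt hρ, div_eq_zero_of_lt hρ', add_zero] at hdiv
    simp only [mul_add_mod_self, mod_eq_of_lt hρ, mod_eq_of_lt hρ'] at hmod
    subst hmod
    have hk := partialSum_index_unique h6 h7 h6' h7'
    apply e.symm.injective
    generalize e.symm i = a at *
    generalize e.symm i' = a' at *
    obtain ⟨⟨j, s⟩, k⟩ := a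
    obtain ⟨⟨j', s'⟩, k'⟩ := a'
    obtain rfl : j = j' := Fin.ext hj
    obtain rfl : s = s' := Subtype.ext hdiv
    obtain rfl : k = k' := hk
    rfl
  · have hmod : 0 < q % κ := pos_iff_ne_zero.2 fun h => hd (dvd_iff_mod_eq_zero.2 h)
    have hs : q / κ < M j := by
      refine lt_of_le_of_ne ?_ fun h => ?_
      · rw [← mul_le_mul_iff_right₀ h0]
        exact (mul_div_le q κ).trans hq
      · refine hd ⟨M j, hq.antisymm ?_⟩
        rw [← h]
        exact mul_div_le q κ
    obtain ⟨k, hk1, hk2⟩ := exists_partialSum_lt_le hmod (hgs _ (mod_lt q h0.ne'))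
    obtain ⟨i, hi⟩ := e.symm.surjective (⟨⟨j, hj⟩, ⟨q / κ, hs⟩⟩, k)
    refine ⟨i, ?_⟩
    rw [hi, add_assoc]
    refine ⟨rfl, ?_, ?_⟩
    · conv_rhs => rw [← div_add_mod q κ]
      exact add_lt_add_right hk1 _
    · conv_lhs => rw [← div_add_mod q κ]
      exact add_le_add_right hk2 _

namespace LayerTiling

variable {κ : Ordinal.{u}} {n : ℕ} {M : ℕ → Ordinal.{u}} (P : LayerTiling κ n M)

open Classical in
/-- The map that places the intervals of all layers one after the other, the `i`-th one onto
`(len 0 + ⋯ + len (i - 1), len 0 + ⋯ + len i]`, and sends points outside the intervals of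
layer `j` to `κ`. -/
noncomputable def toLine (j : ℕ) (q : Ordinal.{u}) : Ordinal.{u} :=
  if h : ∃ i, P.layer i = j ∧ P.left i < q ∧ q ≤ P.left i + P.len i then
    partialSum P.len h.choose + (q - P.left h.choose)
  else κ

lemma toLine_of_mem {i : ℕ} {q : Ordinal.{u}} (h1 : P.left i < q) (h2 : q ≤ P.left i + P.len i) :
    P.toLine (P.layer i) q = partialSum P.len i + (q - P.left i) := by
  have h : ∃ i', P.layer i' = P.layer i ∧ P.left i' < q ∧ q ≤ P.left i' + P.len i' :=
    ⟨i, rfl, h1, h2⟩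
  obtain ⟨h3, h4, h5⟩ := h.choose_spec
  rw [toLine, dif_pos h, P.eq_of_mem _ i q h3 h4 h5 h1 h2]

lemma toLine_of_dvd (j : ℕ) {q : Ordinal.{u}} (h : κ ∣ q) : P.toLine j q = κ :=
  dif_neg fun ⟨i, _, h1, h2⟩ => P.not_dvd i q h1 h2 h

lemma toLine_mem_piece {i : ℕ} {q : Ordinal.{u}} (h1 : P.left i < q)
    (h2 : q ≤ P.left i + P.len i) :
    partialSum P.len i < P.toLine (P.layer i) q ∧
      P.toLine (P.layer i) q ≤ partialSum P.len (i + 1) := by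
  rw [P.toLine_of_mem h1 h2]
  constructor
  · conv_lhs => rw [← add_zero (partialSum P.len i)]
    exact add_lt_add_right (lt_sub.2 (by simpa using h1)) _
  · exact add_le_add_right (Ordinal.sub_le.2 h2) _

lemma toLine_pos_le (hκ : IsPrincipal (· + ·) κ) (h0 : 0 < κ) (j : ℕ) (q : Ordinal.{u}) :
    0 < P.toLine j q ∧ P.toLine j q ≤ κ := by
  by_cases h : ∃ i, P.layer i = j ∧ P.left i < q ∧ q ≤ P.left i + P.len i
  · obtain ⟨i, rfl, h1, h2⟩ := h
    obtain ⟨h3, h4⟩ := P.toLine_mem_piece h1 h2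
    exact ⟨(zero_le).trans_lt h3, h4.trans (partialSum_lt hκ h0 P.len_lt _).le⟩
  · rw [toLine, dif_neg h]
    exact ⟨h0, le_rfl⟩

lemma toLine_eq_toLine (hκ : IsPrincipal (· + ·) κ) (h0 : 0 < κ) {j k : ℕ} (hj : j < n)
    (hk : k < n) {q q' : Ordinal.{u}} (hq : q ≤ κ * M j) (hq' : q' ≤ κ * M k)
    (h : P.toLine j q = P.toLine k q') : (j = k ∧ q = q') ∨ (κ ∣ q ∧ κ ∣ q') := by
  have hlt : ∀ l < n, ∀ p ≤ κ * M l, P.toLine l p = κ → κ ∣ p := by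
    intro l hl p hp hpκ
    by_contra hd
    obtain ⟨i, rfl, h1, h2⟩ := P.exists_mem l hl p hp hd
    exact ((P.toLine_mem_piece h1 h2).2.trans_lt (partialSum_lt hκ h0 P.len_lt _)).ne hpκ
  by_cases hd : κ ∣ q
  · exact Or.inr ⟨hd, hlt k hk q' hq' (h ▸ P.toLine_of_dvd j hd)⟩
  by_cases hd' : κ ∣ q'
  · exact Or.inr ⟨hlt j hj q hq (h.trans (P.toLine_of_dvd k hd')), hd'⟩
  obtain ⟨i, rfl, h1, h2⟩ := P.exists_mem j hj q hq hd
  obtain ⟨i', rfl, h3, h4⟩ := P.exists_mem k hk q' hq' hd'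
  have h5 := P.toLine_mem_piece h1 h2
  have h6 := P.toLine_mem_piece h3 h4
  rw [← h] at h6
  obtain rfl := partialSum_index_unique h5.1 h5.2 h6.1 h6.2
  rw [P.toLine_of_mem h1 h2, P.toLine_of_mem h3 h4] at h
  refine Or.inl ⟨rfl, ?_⟩
  rw [← Ordinal.add_sub_cancel_of_le h1.le, add_left_cancel h, Ordinal.add_sub_cancel_of_le h3.le]

lemma exists_toLine_eq {x : Ordinal.{u}} (hx : 0 < x) (hxκ : x < κ) :
    ∃ j < n, ∃ q ≤ κ * M j, 0 < q ∧ P.toLine j q = x := by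
  obtain ⟨i, h1, h2⟩ := exists_partialSum_lt_le hx (P.cofinal x hxκ)
  obtain ⟨ρ, rfl⟩ : ∃ ρ, x = partialSum P.len i + ρ :=
    ⟨x - partialSum P.len i, (Ordinal.add_sub_cancel_of_le h1.le).symm⟩
  have hρ : ρ ≤ P.len i := le_of_add_le_add_left h2
  have hρ0 : 0 < ρ := by
    rw [pos_iff_ne_zero]
    rintro rfl
    simp at h1
  have h3 : P.left i < P.left i + ρ := by
    conv_lhs => rw [← add_zero (P.left i)]
    exact add_lt_add_right hρ0 _
  have h4 : P.left i + ρ ≤ P.left i + P.len i := add_le_add_right hρ _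
  refine ⟨P.layer i, P.layer_lt i, P.left i + ρ, h4.trans (P.right_le i),
    (zero_le).trans_lt h3, ?_⟩
  rw [P.toLine_of_mem h3 h4, Ordinal.add_sub_cancel]

/-- The partial sums of the lengths are cofinal in `κ`, so only finitely many intervals contain
points whose image is at most a given `b < κ`. -/
lemma continuous_toLine (hκ : IsPrincipal (· + ·) κ) (h0 : 0 < κ) (hs : Order.IsSuccPrelimit κ)
    (j : ℕ) : Continuous (P.toLine j) := by
  refine continuous_of_isClopen_le fun b => ?_
  rcases le_or_gt κ b with hb | hb
  · convert isClopen_univ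
    ext q
    simpa using (P.toLine_pos_le hκ h0 j q).2.trans hb
  obtain ⟨N, hN⟩ := P.cofinal _ (hs.succ_lt hb)
  have hN' : b < partialSum P.len (N + 1) :=
    (Order.lt_succ b).trans_le (hN.trans (le_partialSum_succ _ _))
  have hset : {q | P.toLine j q ≤ b} = ⋃ i ∈ Finset.range (N + 1),
      {q | (P.layer i = j ∧ partialSum P.len i ≤ b) ∧
        P.left i < q ∧ q ≤ P.left i + P.len i ∧ q ≤ P.left i + (b - partialSum P.len i)} := by
    ext q
    simp only [Set.mem_ofPred_eq, Set.mem_iUnion, Finset.mem_range, exists_prop]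
    constructor
    · intro hq
      by_cases h : ∃ i, P.layer i = j ∧ P.left i < q ∧ q ≤ P.left i + P.len i
      · obtain ⟨i, rfl, h1, h2⟩ := h
        have h3 := ((P.toLine_mem_piece h1 h2).1.trans_le hq)
        refine ⟨i, ?_, ⟨rfl, h3.le⟩, h1, h2, ?_⟩
        · by_contra! hi
          exact (h3.trans_le (hN'.le.trans (partialSum_mono _ hi))).false
        · rwa [P.toLine_of_mem h1 h2, ← Ordinal.le_sub_of_le h3.le, Ordinal.sub_le] at hq
      · rw [toLine, dif_neg h] at hq
        exact absurd hb hq.not_gt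
    · rintro ⟨i, -, ⟨rfl, h3⟩, h1, h2, h4⟩
      rwa [P.toLine_of_mem h1 h2, ← Ordinal.le_sub_of_le h3, Ordinal.sub_le]
  rw [hset]
  refine isClopen_biUnion_finset fun i _ => ?_
  by_cases hi : P.layer i = j ∧ partialSum P.len i ≤ b
  · simp only [hi, and_self, true_and]
    exact (isClopen_Ioi _).inter ((isClopen_Iic _).inter (isClopen_Iic _))
  · simp [hi, isClopen_empty]

end LayerTiling

/-! ### The layers of an ordinal interval -/

lemma Ordinal.ceilQuot_pow_le {κ β x : Ordinal.{u}} (hκ : κ ≠ 0) {n j : ℕ} (hj : j < n)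
    (hx : x ≤ κ ^ n * β) : ceilQuot x (κ ^ j) ≤ κ * (κ ^ (n - j - 1) * β) := by
  rw [ceilQuot_le_iff (pow_ne_zero _ hκ), ← mul_assoc, ← mul_assoc, ← pow_succ, ← pow_add]
  rwa [show j + 1 + (n - j - 1) = n by lia]

lemma Ordinal.pow_mul_mul_pow_sub_mul {κ β : Ordinal.{u}} {n j : ℕ} (hj : j < n) :
    κ ^ j * (κ * (κ ^ (n - j - 1) * β)) = κ ^ n * β := by
  rw [← mul_assoc, ← mul_assoc, ← pow_succ, ← pow_add, show j + 1 + (n - j - 1) = n by lia]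

/-- Rounding up to a multiple of `κ ^ j`, with `j ≤ n`, does not leave `[0, κ ^ n * β]`. -/
lemma Ordinal.round_pow_le {κ β x : Ordinal.{u}} (hκ : κ ≠ 0) {n j : ℕ} (hj : j ≤ n)
    (hx : x ≤ κ ^ n * β) : κ ^ j * ceilQuot x (κ ^ j) ≤ κ ^ n * β := by
  have h : κ ^ n * β = κ ^ j * (κ ^ (n - j) * β) := by
    rw [← mul_assoc, ← pow_add, Nat.add_sub_cancel' hj]
  rw [h] at hx ⊢
  exact mul_le_mul_right ((ceilQuot_le_iff (pow_ne_zero _ hκ)).2 hx) _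

lemma Ordinal.eq_of_sub_one_eq {x y : Ordinal.{u}} (hx : 0 < x) (hy : 0 < y) (h : x - 1 = y - 1) :
    x = y := by
  rw [← Ordinal.add_sub_cancel_of_le (Order.one_le_iff_pos.2 hx), h,
    Ordinal.add_sub_cancel_of_le (Order.one_le_iff_pos.2 hy)]

lemma Ordinal.sub_one_of_one_add {κ : Ordinal.{u}} (h : 1 + κ = κ) : κ - 1 = κ := by
  conv_lhs => rw [← h]
  exact Ordinal.add_sub_cancel 1 κ

section

variable {κ : Ordinal.{u}} (hκ : IsPrincipal (· + ·) κ) (h0 : 0 < κ) (h1 : 1 + κ = κ)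
  (hs : Order.IsSuccPrelimit κ)
include hκ h0 h1 hs

/-- In `[0, κ ^ n * β]` the layers are the sets of multiples of `κ ^ j` for `j ≤ n`, all of them
with base point `0`, and the last layer is a copy of `[κ, κ + β]`. The subtraction of `1` makes the
images of the other layers cover `[0, κ)` rather than `(0, κ)`. -/
noncomputable def layeredMapsAdd {n : ℕ} {β : Ordinal.{u}}
    (P : LayerTiling κ n fun j => κ ^ (n - j - 1) * β) :
    LayeredMaps (OrdInterval (κ + β)) (OrdInterval (κ ^ n * β)) n where
  r j y := ⟨κ ^ min j n * ceilQuot y (κ ^ min j n), zero_le,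
    round_pow_le h0.ne' (min_le_right _ _) y.2.2⟩
  ψ j y := ⟨P.toLine j (ceilQuot y (κ ^ j)) - 1, zero_le,
    (Ordinal.sub_le_self _ _).trans
      ((P.toLine_pos_le hκ h0 _ _).2.trans (le_add_right le_rfl))⟩
  p y := ⟨κ + ceilQuot y (κ ^ n), zero_le,
    add_le_add_right ((ceilQuot_le_iff (pow_ne_zero _ h0.ne')).2 y.2.2) κ⟩
  x₀ := ⟨κ, zero_le, le_add_right le_rfl⟩
  y₀ := ⟨0, le_rfl, zero_le⟩
  continuous_r j := ((continuous_const_mul (pow_ne_zero _ h0.ne')).comp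
    ((continuous_ceilQuot (pow_ne_zero _ h0.ne')).comp continuous_subtype_val)).subtype_mk _
  continuous_ψ j := ((continuous_sub_const 1).comp ((P.continuous_toLine hκ h0 hs j).comp
    ((continuous_ceilQuot (pow_ne_zero _ h0.ne')).comp continuous_subtype_val))).subtype_mk _
  continuous_p := ((Ordinal.continuous_const_add κ).comp
    ((continuous_ceilQuot (pow_ne_zero _ h0.ne')).comp continuous_subtype_val)).subtype_mk _
  r_zero y := Subtype.ext (by simp [ceilQuot_one_right])
  p_r k hk y := Subtype.ext (by simp [hk, ceilQuot_pow_round_of_le h0.ne' hk])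
  ψ_r_of_le j hj k hk y := Subtype.ext (by
    simp [hk.trans hj.le, ceilQuot_pow_round_of_le h0.ne' hk])
  ψ_r_of_lt k hk j hj y := Subtype.ext (by
    simp [hk, P.toLine_of_dvd j (dvd_ceilQuot_pow_mul h0.ne' hj _), sub_one_of_one_add h1])
  p_y₀ := by simp
  ψ_y₀ j hj := Subtype.ext (by simp [P.toLine_of_dvd j (dvd_zero κ), sub_one_of_one_add h1])
  cover x := by
    rcases le_or_gt κ x.1 with hx | hx
    · refine Or.inl ⟨⟨κ ^ n * (x.1 - κ), zero_le,
        mul_le_mul_right (Ordinal.sub_le.2 x.2.2) _⟩, Subtype.ext ?_⟩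
      simp [ceilQuot_mul_cancel (pow_ne_zero n h0.ne'), Ordinal.add_sub_cancel_of_le hx]
    · have hx' : 1 + x.1 < κ := (add_lt_add_right hx 1).trans_eq h1
      obtain ⟨j, hj, q, hq, -, hqx⟩ :=
        P.exists_toLine_eq (lt_of_lt_of_le zero_lt_one (le_add_right le_rfl)) hx'
      refine Or.inr ⟨j, hj, ⟨κ ^ j * q, zero_le, ?_⟩, Subtype.ext ?_⟩
      · rw [← pow_mul_mul_pow_sub_mul hj]
        exact mul_le_mul_right hq _
      · simp [ceilQuot_mul_cancel (pow_ne_zero j h0.ne'), hqx, Ordinal.add_sub_cancel]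
  p_eq_p y z h := by
    have h := add_left_cancel (congrArg Subtype.val h)
    exact Subtype.ext (by simp [h])
  ψ_eq_ψ j hj k hk y z h := by
    have h := eq_of_sub_one_eq (P.toLine_pos_le hκ h0 _ _).1 (P.toLine_pos_le hκ h0 _ _).1
      (congrArg Subtype.val h)
    rcases P.toLine_eq_toLine hκ h0 hj hk (ceilQuot_pow_le h0.ne' hj y.2.2)
      (ceilQuot_pow_le h0.ne' hk z.2.2) h with ⟨rfl, hyz⟩ | ⟨hy, hz⟩
    · refine Or.inl ⟨rfl, Subtype.ext ?_, Subtype.ext ?_⟩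
      · simp [hj.le, hyz]
      · simp [Nat.succ_le_of_lt hj, round_succ_congr h0.ne' hyz]
    · refine Or.inr ⟨Subtype.ext ?_, Subtype.ext ?_⟩
      · simpa [hj.le, Nat.succ_le_of_lt hj] using round_eq_round_succ h0.ne' hy
      · simpa [hk.le, Nat.succ_le_of_lt hk] using round_eq_round_succ h0.ne' hz
  p_eq_ψ j hj y z h := by
    have h : κ + ceilQuot y.1 (κ ^ n) = P.toLine j (ceilQuot z.1 (κ ^ j)) - 1 :=
      congrArg Subtype.val h
    have hle : P.toLine j (ceilQuot z.1 (κ ^ j)) - 1 ≤ κ :=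
      (Ordinal.sub_le_self _ _).trans (P.toLine_pos_le hκ h0 _ _).2
    have hy : ceilQuot y.1 (κ ^ n) = 0 := by
      have h2 : κ + ceilQuot y.1 (κ ^ n) ≤ κ + 0 := by rw [h, add_zero]; exact hle
      exact le_antisymm (le_of_add_le_add_left h2) zero_le
    rw [hy, add_zero] at h
    have hz : P.toLine j (ceilQuot z.1 (κ ^ j)) = P.toLine j 0 := by
      refine eq_of_sub_one_eq (P.toLine_pos_le hκ h0 _ _).1 (P.toLine_pos_le hκ h0 _ _).1 ?_
      rw [← h, P.toLine_of_dvd j (dvd_zero κ), sub_one_of_one_add h1]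
    have hz' : κ ∣ ceilQuot z.1 (κ ^ j) := by
      rcases P.toLine_eq_toLine hκ h0 hj hj (ceilQuot_pow_le h0.ne' hj z.2.2) zero_le hz with
        ⟨-, h⟩ | ⟨h, -⟩
      · rw [h]; exact dvd_zero κ
      · exact h
    refine ⟨Subtype.ext (by simp [hy]), Subtype.ext ?_⟩
    simpa [hj.le, Nat.succ_le_of_lt hj] using round_eq_round_succ h0.ne' hz'

/-- In `[0, κ ^ (m + 1)]`, identified with `(0, κ ^ (m + 1)]` by `y ↦ 1 + y`, the layers are the
sets of positive multiples of `κ ^ j` for `j ≤ m`. The last of them is treated like the others and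
its greatest element `κ ^ (m + 1)` is the base point, so that all the images lie in `[0, κ]`. -/
noncomputable def layeredMapsPow {m : ℕ}
    (P : LayerTiling κ (m + 1) fun j => κ ^ (m + 1 - j - 1) * 1) :
    LayeredMaps (OrdInterval κ) (OrdInterval (κ ^ (m + 1))) m :=
  have hpow : 1 + κ ^ (m + 1) = κ ^ (m + 1) := by
    rw [pow_succ']
    obtain ⟨c, hc⟩ : ∃ c, κ ^ m = 1 + c := ⟨κ ^ m - 1, (Ordinal.add_sub_cancel_of_le
      (Order.one_le_iff_pos.2 (pos_iff_ne_zero.2 (pow_ne_zero _ h0.ne')))).symm⟩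
    rw [hc, mul_add, mul_one, ← add_assoc, h1]
  have hle : ∀ y : OrdInterval (κ ^ (m + 1)), 1 + y.1 ≤ κ ^ (m + 1) * 1 := fun y => by
    rw [mul_one]
    exact (add_le_add_right y.2.2 1).trans_eq hpow
  have hround : ∀ (y : Ordinal.{u}) (j : ℕ),
      1 + (κ ^ j * ceilQuot (1 + y) (κ ^ j) - 1) = κ ^ j * ceilQuot (1 + y) (κ ^ j) := fun y j =>
    Ordinal.add_sub_cancel_of_le
      ((le_add_right le_rfl).trans (le_mul_ceilQuot (pow_ne_zero _ h0.ne')))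
  have hlast : ∀ y : OrdInterval (κ ^ (m + 1)), κ ∣ ceilQuot (1 + y.1) (κ ^ m) →
      ceilQuot (1 + y.1) (κ ^ m) = κ := fun y hy => by
    refine le_antisymm ?_ (Ordinal.le_of_dvd (ceilQuot_pos (pow_ne_zero _ h0.ne')
      (lt_of_lt_of_le zero_lt_one (le_add_right le_rfl))).ne' hy)
    simpa using ceilQuot_pow_le h0.ne' (Nat.lt_succ_self m) (hle y)
  have hdvd : ∀ j ≤ m, κ ∣ ceilQuot (κ ^ (m + 1)) (κ ^ j) := fun j hj => by
    simpa using dvd_ceilQuot_pow_mul h0.ne' (Nat.lt_succ_of_le hj) 1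
  have htop : κ ^ (m + 1) = κ ^ m * κ := pow_succ κ m
  have hcont : Continuous fun y : OrdInterval (κ ^ (m + 1)) => 1 + y.1 :=
    (Ordinal.continuous_const_add 1).comp continuous_subtype_val
  { r j y := ⟨κ ^ min j m * ceilQuot (1 + y) (κ ^ min j m) - 1, zero_le,
      (Ordinal.sub_le_self _ _).trans (by
        simpa using round_pow_le h0.ne' ((min_le_right j m).trans m.le_succ) (hle y))⟩
    ψ j y := ⟨P.toLine j (ceilQuot (1 + y) (κ ^ j)) - 1, zero_le,
      (Ordinal.sub_le_self _ _).trans (P.toLine_pos_le hκ h0 _ _).2⟩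
    p y := ⟨P.toLine m (ceilQuot (1 + y) (κ ^ m)) - 1, zero_le,
      (Ordinal.sub_le_self _ _).trans (P.toLine_pos_le hκ h0 _ _).2⟩
    x₀ := ⟨κ, zero_le, le_rfl⟩
    y₀ := ⟨κ ^ (m + 1), zero_le, le_rfl⟩
    continuous_r j := ((continuous_sub_const 1).comp
      ((continuous_const_mul (pow_ne_zero _ h0.ne')).comp
        ((continuous_ceilQuot (pow_ne_zero _ h0.ne')).comp hcont))).subtype_mk _
    continuous_ψ j := ((continuous_sub_const 1).comp ((P.continuous_toLine hκ h0 hs j).comp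
      ((continuous_ceilQuot (pow_ne_zero _ h0.ne')).comp hcont))).subtype_mk _
    continuous_p := ((continuous_sub_const 1).comp ((P.continuous_toLine hκ h0 hs m).comp
      ((continuous_ceilQuot (pow_ne_zero _ h0.ne')).comp hcont))).subtype_mk _
    r_zero y := Subtype.ext (by simp [ceilQuot_one_right, Ordinal.add_sub_cancel])
    p_r k hk y := Subtype.ext (by simp [hk, hround, ceilQuot_pow_round_of_le h0.ne' hk])
    ψ_r_of_le j hj k hk y := Subtype.ext (by
      simp [hk.trans hj.le, hround, ceilQuot_pow_round_of_le h0.ne' hk])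
    ψ_r_of_lt k hk j hj y := Subtype.ext (by
      simp [hk, hround, P.toLine_of_dvd j (dvd_ceilQuot_pow_mul h0.ne' hj _),
        sub_one_of_one_add h1])
    p_y₀ := Subtype.ext (by
      simp [hpow, P.toLine_of_dvd m (hdvd m le_rfl), sub_one_of_one_add h1])
    ψ_y₀ j hj := Subtype.ext (by
      simp [hpow, P.toLine_of_dvd j (hdvd j hj.le), sub_one_of_one_add h1])
    cover x := by
      rcases le_or_gt κ x.1 with hx | hx
      · refine Or.inl ⟨⟨κ ^ (m + 1), zero_le, le_rfl⟩, Subtype.ext ?_⟩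
        simpa [hpow, P.toLine_of_dvd m (hdvd m le_rfl), sub_one_of_one_add h1] using hx.antisymm x.2.2
      · have hx' : 1 + x.1 < κ := (add_lt_add_right hx 1).trans_eq h1
        obtain ⟨j, hj, q, hq, hq0, hqx⟩ :=
          P.exists_toLine_eq (lt_of_lt_of_le zero_lt_one (le_add_right le_rfl)) hx'
        have hle' : κ ^ j * q ≤ κ ^ (m + 1) := by
          rw [← mul_one (κ ^ (m + 1)), ← pow_mul_mul_pow_sub_mul hj]
          exact mul_le_mul_right hq _
        have hpos : 0 < κ ^ j * q :=
          pos_iff_ne_zero.2 (mul_ne_zero (pow_ne_zero _ h0.ne') hq0.ne')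
        have hcancel : 1 + (κ ^ j * q - 1) = κ ^ j * q :=
          Ordinal.add_sub_cancel_of_le (Order.one_le_iff_pos.2 hpos)
        have hval : P.toLine j (ceilQuot (1 + (κ ^ j * q - 1)) (κ ^ j)) - 1 = x.1 := by
          rw [hcancel, ceilQuot_mul_cancel (pow_ne_zero j h0.ne'), hqx, Ordinal.add_sub_cancel]
        rcases Nat.lt_succ_iff_lt_or_eq.1 hj with hj | rfl
        · exact Or.inr ⟨j, hj, ⟨κ ^ j * q - 1, zero_le, (Ordinal.sub_le_self _ _).trans hle'⟩,
            Subtype.ext hval⟩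
        · exact Or.inl ⟨⟨κ ^ j * q - 1, zero_le, (Ordinal.sub_le_self _ _).trans hle'⟩,
            Subtype.ext hval⟩
    p_eq_p y z h := by
      have h := eq_of_sub_one_eq (P.toLine_pos_le hκ h0 _ _).1 (P.toLine_pos_le hκ h0 _ _).1
        (congrArg Subtype.val h)
      rcases P.toLine_eq_toLine hκ h0 m.lt_succ_self m.lt_succ_self
        (ceilQuot_pow_le h0.ne' m.lt_succ_self (hle y))
        (ceilQuot_pow_le h0.ne' m.lt_succ_self (hle z)) h with ⟨-, hyz⟩ | ⟨hy, hz⟩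
      · exact Subtype.ext (by simp [hyz])
      · exact Subtype.ext (by simp [hlast y hy, hlast z hz])
    ψ_eq_ψ j hj k hk y z h := by
      have h := eq_of_sub_one_eq (P.toLine_pos_le hκ h0 _ _).1 (P.toLine_pos_le hκ h0 _ _).1
        (congrArg Subtype.val h)
      rcases P.toLine_eq_toLine hκ h0 (hj.trans m.lt_succ_self) (hk.trans m.lt_succ_self)
        (ceilQuot_pow_le h0.ne' (hj.trans m.lt_succ_self) (hle y))
        (ceilQuot_pow_le h0.ne' (hk.trans m.lt_succ_self) (hle z)) h with ⟨rfl, hyz⟩ | ⟨hy, hz⟩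
      · refine Or.inl ⟨rfl, Subtype.ext ?_, Subtype.ext ?_⟩
        · simp [hj.le, hyz]
        · simp [Nat.succ_le_of_lt hj, round_succ_congr h0.ne' hyz]
      · refine Or.inr ⟨Subtype.ext ?_, Subtype.ext ?_⟩
        · simp [hj.le, Nat.succ_le_of_lt hj, round_eq_round_succ h0.ne' hy]
        · simp [hk.le, Nat.succ_le_of_lt hk, round_eq_round_succ h0.ne' hz]
    p_eq_ψ j hj y z h := by
      have h := eq_of_sub_one_eq (P.toLine_pos_le hκ h0 _ _).1 (P.toLine_pos_le hκ h0 _ _).1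
        (congrArg Subtype.val h)
      rcases P.toLine_eq_toLine hκ h0 m.lt_succ_self (hj.trans m.lt_succ_self)
        (ceilQuot_pow_le h0.ne' m.lt_succ_self (hle y))
        (ceilQuot_pow_le h0.ne' (hj.trans m.lt_succ_self) (hle z)) h with ⟨hmj, -⟩ | ⟨hy, hz⟩
      · exact absurd hmj hj.ne'
      · refine ⟨Subtype.ext ?_, Subtype.ext ?_⟩
        · simpa [hlast y hy, ← htop] using sub_one_of_one_add hpow
        · simp [hj.le, Nat.succ_le_of_lt hj, round_eq_round_succ h0.ne' hz] }

end

/-! ### Countable powers of `ω` -/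

lemma Ordinal.countable_Iio {a : Ordinal.{u}} (ha : a.card ≤ ℵ₀) : (Set.Iio a).Countable := by
  rw [← Cardinal.le_aleph0_iff_set_countable, Cardinal.mk_Iio_ordinal, Cardinal.lift_le_aleph0]
  exact ha

lemma Ordinal.card_pow_le_aleph0 {κ : Ordinal.{u}} (hκ : κ.card ≤ ℵ₀) (k : ℕ) :
    (κ ^ k).card ≤ ℵ₀ := by
  induction k with
  | zero => simp
  | succ k ih =>
    rw [pow_succ, card_mul]
    exact (mul_le_mul' ih hκ).trans Cardinal.aleph0_mul_aleph0.le

lemma nonempty_layerTiling_opow {α β : Ordinal.{u}} (hα : α.card ≤ ℵ₀) (hβ : β.card ≤ ℵ₀)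
    (hβ0 : β ≠ 0) {n : ℕ} (hn : 1 ≤ n) :
    Nonempty (LayerTiling (ω ^ α) n fun j => (ω ^ α) ^ (n - j - 1) * β) := by
  have h0 : ω ^ α ≠ 0 := (opow_pos α omega0_pos).ne'
  have hκc : (ω ^ α).card ≤ ℵ₀ := (card_opow_le _ _).trans (by simp [hα])
  refine LayerTiling.nonempty (isPrincipal_add_omega0_opow α) (opow_pos α omega0_pos)
    (countable_Iio hκc) hn (fun j _ => mul_ne_zero (pow_ne_zero _ h0) hβ0) fun j _ => ?_
  refine countable_Iio ?_
  rw [card_mul]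
  exact (mul_le_mul' (card_pow_le_aleph0 hκc _) hβ).trans Cardinal.aleph0_mul_aleph0.le

lemma positiveBanachMazurDist_le_of_exists {K L : Type*} [TopologicalSpace K] [CompactSpace K]
    [TopologicalSpace L] [CompactSpace L] {c : ℝ}
    (h : ∃ T : C(K, ℝ) ≃L[ℝ] C(L, ℝ), IsPositiveIso T ∧ distortion T ≤ c) :
    positiveBanachMazurDist K L ≤ ENNReal.ofReal c := by
  obtain ⟨T, hT, hc⟩ := h
  exact (iInf₂_le T hT).trans (ENNReal.ofReal_le_ofReal hc)

lemma distortion_refl_le (K : Type*) [TopologicalSpace K] [CompactSpace K] :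
    distortion (ContinuousLinearEquiv.refl ℝ C(K, ℝ)) ≤ 1 :=
  mul_le_one₀ ContinuousLinearMap.norm_id_le (by positivity) ContinuousLinearMap.norm_id_le

theorem mainTheorem6 (α β : Ordinal.{u}) (hα : α.card ≤ ℵ₀) (hα0 : α ≠ 0)
    (hβ : β.card ≤ ℵ₀) (hβ0 : β ≠ 0) (n : ℕ) (hn : 1 ≤ n) :
    (positiveBanachMazurDist (OrdInterval (ω ^ α + β)) (OrdInterval (ω ^ (α * (n : Ordinal.{u})) * β))
        ≤ ENNReal.ofReal ((n : ℝ) + 1 + √((n : ℝ) * ((n : ℝ) + 4))) ∧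
      ∃ T : C(OrdInterval (ω ^ α + β), ℝ) ≃L[ℝ]
          C(OrdInterval (ω ^ (α * (n : Ordinal.{u})) * β), ℝ),
        IsPositiveIso T ∧ distortion T ≤ (n : ℝ) + 1 + √((n : ℝ) * ((n : ℝ) + 4))) ∧
    (positiveBanachMazurDist (OrdInterval (ω ^ α)) (OrdInterval (ω ^ (α * (n : Ordinal.{u}))))
        ≤ ENNReal.ofReal ((n : ℝ) + √(((n : ℝ) - 1) * ((n : ℝ) + 3))) ∧
      ∃ T : C(OrdInterval (ω ^ α), ℝ) ≃L[ℝ] C(OrdInterval (ω ^ (α * (n : Ordinal.{u}))), ℝ),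
        IsPositiveIso T ∧ distortion T ≤ (n : ℝ) + √(((n : ℝ) - 1) * ((n : ℝ) + 3))) := by
  have hκ := isPrincipal_add_omega0_opow α
  have h0 : 0 < ω ^ α := opow_pos α omega0_pos
  have h1 : 1 + ω ^ α = ω ^ α := one_add_of_omega0_le (left_le_opow ω (pos_iff_ne_zero.2 hα0))
  have hs : Order.IsSuccPrelimit (ω ^ α) :=
    (isSuccLimit_opow_left isSuccLimit_omega0 hα0).isSuccPrelimit
  have hpow : ω ^ (α * (n : Ordinal.{u})) = (ω ^ α) ^ n := by rw [opow_mul, opow_natCast]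
  rw [hpow]
  suffices H : (∃ T : C(OrdInterval (ω ^ α + β), ℝ) ≃L[ℝ] C(OrdInterval ((ω ^ α) ^ n * β), ℝ),
      IsPositiveIso T ∧ distortion T ≤ (n : ℝ) + 1 + √((n : ℝ) * ((n : ℝ) + 4))) ∧
      ∃ T : C(OrdInterval (ω ^ α), ℝ) ≃L[ℝ] C(OrdInterval ((ω ^ α) ^ n), ℝ),
        IsPositiveIso T ∧ distortion T ≤ (n : ℝ) + √(((n : ℝ) - 1) * ((n : ℝ) + 3)) from
    ⟨⟨positiveBanachMazurDist_le_of_exists H.1, H.1⟩,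
      ⟨positiveBanachMazurDist_le_of_exists H.2, H.2⟩⟩
  constructor
  · obtain ⟨P⟩ := nonempty_layerTiling_opow hα hβ hβ0 hn
    exact (layeredMapsAdd hκ h0 h1 hs P).exists_isPositiveIso hn
  · obtain ⟨m, rfl⟩ := Nat.exists_eq_add_of_le' hn
    rcases Nat.eq_zero_or_pos m with rfl | hm
    · rw [zero_add, pow_one]
      exact ⟨.refl ℝ _, fun f hf => hf, (distortion_refl_le _).trans (by simp)⟩
    · obtain ⟨P⟩ := nonempty_layerTiling_opow hα (β := 1) (by simp) one_ne_zero hn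
      have hm1 : ((m + 1 : ℕ) : ℝ) + √((((m + 1 : ℕ) : ℝ) - 1) * (((m + 1 : ℕ) : ℝ) + 3)) =
          (m : ℝ) + 1 + √((m : ℝ) * ((m : ℝ) + 4)) := by
        rw [Nat.cast_add_one, add_sub_cancel_right, add_assoc (m : ℝ) 1 3]
        norm_num
      rw [hm1]
      exact (layeredMapsPow hκ h0 h1 hs P).exists_isPositiveIso hm
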